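/- Let $\beta>0$ and let $L:\mathbb{R}_+\to\mathbb{R}$ be slowly varying at infinity, i.e. $L(\lambda z)/L(z)\to 1$ as $z\to+\infty$ for every $\lambda>0$. Let $S_1,S_2,\ldots$ be independent, identically distributed random variables, copies of a random variable $S$ with values in $\{1,2,3,\ldots\}$ such that $\mathbb{P}(S>x)=x^{-\beta}L(x)$ for all real $x\ge 1$. For real $k$ and $n\ge 1$ put $$p_k=\mathbb{P}(S>e^k),\qquad \widehat p^{(n)}_k=\frac1n\sum_{i=1}^n\mathbb{I}\{S_i>e^k\},$$ $$\widehat\beta_n(k)=\ln\widehat p^{(n)}_k-\ln\widehat p^{(n)}_{k+1}\ \text{ if }\widehat p^{(n)}_{k+1}>0,\qquad \widehat\beta_n(k)=0\ \text{ if }\widehat p^{(n)}_{k+1}=0.$$ Let $(k_n)_{n\ge1}$ be a (deterministic) sequence of real numbers such that, as $n\to+\infty$: $k_n\to+\infty$, $k_n=o(n)$, $\dfrac{(\ln n)\,e^{k_n\beta}}{n}=o\big(L(e^{k_n})\big)$, and $$\sqrt{n p_{k_n}}\left(1-\frac{L(e^{k_n})}{L(e^{k_n+1})}\right)\to 0 .$$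 Then, as $n\to+\infty$, the following convergences in distribution hold: (i) $\sqrt{n p_{k_n}}\,\big(\widehat\beta_n(k_n)-\beta\big)\Rightarrow\mathcal{N}(0,\,e^\beta-1)$; (ii) $\dfrac{\sqrt{n\widehat p^{(n)}_{k_n}}\,\big(\widehat\beta_n(k_n)-\beta\big)}{\sqrt{e^{\widehat\beta_n(k_n)}-1}}\Rightarrow\mathcal{N}(0,1)$, where the left-hand side is set to $0$ on the event $\{\widehat\beta_n(k_n)=0\}$, whose probability tends to $0$. -/

import Mathlib

open MeasureTheory ProbabilityTheory Filter Topology Asymptotics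

noncomputable section

/-- `L` is slowly varying at infinity: `L (c * x) / L x → 1` as `x → ∞`, for every `c > 0`. -/
def SlowlyVarying (L : ℝ → ℝ) : Prop :=
  ∀ c : ℝ, 0 < c → Tendsto (fun x : ℝ => L (c * x) / L x) atTop (𝓝 1)

/-- The exponentially separated tail probability `p_k = ℙ(X > e^k)`, for a real level `k`. -/
def tailProb {Ω : Type*} [MeasurableSpace Ω] (P : Measure Ω) (X : Ω → ℕ) (k : ℝ) : ℝ :=
  P.real {ω | Real.exp k < (X ω : ℝ)}

/-- The empirical tail probability
`(1/n) ∑_{i=1}^n 𝟙{S_i > e^k}`; the sample is indexed from `0`, so the first `n`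
observations are `S 0, …, S (n - 1)`. -/
def empTail {Ω : Type*} (S : ℕ → Ω → ℕ) (n : ℕ) (k : ℝ) (ω : Ω) : ℝ :=
  (1 / (n : ℝ)) *
    ∑ i ∈ Finset.range n, Set.indicator {ω' | Real.exp k < (S i ω' : ℝ)} (fun _ => (1 : ℝ)) ω

open Classical in
/-- The estimator `log p̂_k - log p̂_{k+1}` of the tail index, set to `0` when `p̂_{k+1} = 0`. -/
def tailIndexEst {Ω : Type*} (S : ℕ → Ω → ℕ) (n : ℕ) (k : ℝ) (ω : Ω) : ℝ :=
  if empTail S n (k + 1) ω = 0 then 0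
  else Real.log (empTail S n k ω) - Real.log (empTail S n (k + 1) ω)

end

/-!
Write `p = p_{k_n}`, `q = p_{k_n + 1}` and let `U = p̂ / p - 1`, `V = q̂ / q - 1` be the relative
errors of the empirical tail probabilities (`relErr`). Outside an event of vanishing probability,

  `β̂ - β = (log p - log q - β) + log (1 + U) - log (1 + V)`.

* The deterministic term equals `log (L(e^k) / L(e^{k+1}))` and vanishes after multiplication by
  `√(n p)`: this is the bias condition (`tendsto_bias`).
* The condition on `k_n` gives `n p ≥ log n` eventually (`tendsto_mul_tailProb_atTop`), and slow
  variation gives `p / q → e^β` (`tendsto_tailProb_div`). As `𝔼 U² ≤ 1 / (n p)` and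
  `𝔼 V² ≤ 1 / (n q)` (`integral_relErr_sq_le`), the variable `√(n p) (U² + V²)` tends to `0` in mean,
  and it dominates the error of replacing `log (1 + U) - log (1 + V)` by `U - V`
  (`tendstoInMeasure_est_sub_linear`). Only first-order linearisation of a difference is needed, so
  no bivariate limit theorem enters.
* `√(n p) (U - V)` is a row sum of a bounded, centred i.i.d. triangular array with row variance
  `p / q - 1 → e^β - 1`, to which a central limit theorem for uniformly small arrays applies
  (`tendstoInDistribution_sum_of_bounded`, `tendstoInDistribution_relErr_sub`).

The studentised statement follows by Slutsky's theorem, since `√(p̂ / p) / √(exp β̂ - 1)` is a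
continuous function of `U`, `V` and `p / q` on the good event
(`tendstoInMeasure_normalisation`).
-/

/-! ### Central limit theorem for uniformly small triangular arrays -/

section BoundedTriangularArray

variable {Ω : Type*} [MeasurableSpace Ω] {P : Measure Ω} [IsProbabilityMeasure P]

/-- Second-order Taylor bound for the characteristic function of a small, centred variable; the
remainder is controlled by the bound on the variable times its second moment. -/
theorem norm_charFun_sub_one_add_le {X : Ω → ℝ} (hX : AEMeasurable X P) {c t : ℝ}
    (hmean : ∫ ω, X ω ∂P = 0) (hbound : ∀ᵐ ω ∂P, |X ω| ≤ c) (htc : |t| * c ≤ 1) :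
    ‖charFun (P.map X) t - 1 + ((t ^ 2 / 2 * ∫ ω, X ω ^ 2 ∂P : ℝ) : ℂ)‖
      ≤ |t| ^ 3 * c * ∫ ω, X ω ^ 2 ∂P := by
  have hX1 : Integrable X P := Integrable.of_bound hX.aestronglyMeasurable c (by simpa using hbound)
  have hX2 : Integrable (fun ω => X ω ^ 2) P := by
    refine Integrable.of_bound (by fun_prop) (c ^ 2) ?_
    filter_upwards [hbound] with ω h
    rw [Real.norm_eq_abs, abs_pow]
    gcongr
  have hE : Integrable (fun ω => Complex.exp (t * X ω * Complex.I)) P := by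
    refine Integrable.of_bound (by fun_prop) 1 (ae_of_all _ fun ω => ?_)
    rw [← Complex.ofReal_mul, Complex.norm_exp_ofReal_mul_I]
  have hXC : Integrable (fun ω => (X ω : ℂ)) P := hX1.ofReal
  have hX2C : Integrable (fun ω => ((X ω ^ 2 : ℝ) : ℂ)) P := hX2.ofReal
  have key : charFun (P.map X) t - 1 + ((t ^ 2 / 2 * ∫ ω, X ω ^ 2 ∂P : ℝ) : ℂ)
      = ∫ ω, (Complex.exp (t * X ω * Complex.I) - 1 - t * Complex.I * X ω
          + t ^ 2 / 2 * ((X ω ^ 2 : ℝ) : ℂ)) ∂P := by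
    have hE1 : Integrable (fun ω => Complex.exp (t * X ω * Complex.I) - 1) P :=
      hE.sub (integrable_const _)
    have hE2 : Integrable
        (fun ω => Complex.exp (t * X ω * Complex.I) - 1 - t * Complex.I * X ω) P :=
      hE1.sub (hXC.const_mul _)
    rw [integral_add hE2 (hX2C.const_mul _), integral_sub hE1 (hXC.const_mul _),
      integral_sub hE (integrable_const _), integral_const_mul, integral_const_mul,
      integral_complex_ofReal, integral_complex_ofReal, hmean, charFun_apply_real,
      integral_map hX (by fun_prop)]
    simp
  rw [key, ← integral_const_mul]
  refine norm_integral_le_of_norm_le (hX2.const_mul _) ?_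
  filter_upwards [hbound] with ω h
  have hz : ‖(t * X ω * Complex.I : ℂ)‖ = |t| * |X ω| := by simp
  have hle : |t| * |X ω| ≤ 1 := le_trans (by gcongr) htc
  have h3 := Complex.exp_bound (x := t * X ω * Complex.I) (by rw [hz]; exact hle)
    (n := 3) (by norm_num)
  rw [hz] at h3
  have hs : ∑ m ∈ Finset.range 3, (t * X ω * Complex.I : ℂ) ^ m / (m.factorial : ℂ)
      = 1 + t * Complex.I * X ω - t ^ 2 / 2 * ((X ω ^ 2 : ℝ) : ℂ) := by
    simp only [Finset.sum_range_succ, Finset.sum_range_zero, Nat.factorial]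
    push_cast
    linear_combination (t ^ 2 * X ω ^ 2 / 2 : ℂ) * Complex.I_sq
  rw [hs] at h3
  calc _ = ‖Complex.exp (t * X ω * Complex.I)
          - (1 + t * Complex.I * X ω - t ^ 2 / 2 * ((X ω ^ 2 : ℝ) : ℂ))‖ := by
        congr 1; ring
    _ ≤ (|t| * |X ω|) ^ 3 * 1 := h3.trans (by gcongr; norm_num [Nat.factorial])
    _ = |t| ^ 3 * |X ω| * X ω ^ 2 := by rw [← sq_abs (X ω)]; ring
    _ ≤ |t| ^ 3 * c * X ω ^ 2 := by gcongr

/-- Central limit theorem for a row-wise i.i.d., centred triangular array whose entries are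
uniformly small; smallness replaces the Lindeberg condition. -/
theorem tendstoInDistribution_sum_of_bounded {X : ℕ → ℕ → Ω → ℝ} {c : ℕ → ℝ} {v : NNReal}
    (hindep : ∀ n, iIndepFun (X n) P) (hident : ∀ n i, IdentDistrib (X n i) (X n 0) P P)
    (hmean : ∀ᶠ n in atTop, ∫ ω, X n 0 ω ∂P = 0)
    (hbound : ∀ᶠ n in atTop, ∀ᵐ ω ∂P, |X n 0 ω| ≤ c n) (hc : Tendsto c atTop (𝓝 0))
    (hvar : Tendsto (fun n : ℕ => (n : ℝ) * ∫ ω, X n 0 ω ^ 2 ∂P) atTop (𝓝 v)) :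
    TendstoInDistribution (fun (n : ℕ) ω => ∑ i ∈ Finset.range n, X n i ω) atTop (id : ℝ → ℝ)
      (fun _ => P) (gaussianReal 0 v) where
  forall_aemeasurable n := Finset.aemeasurable_fun_sum _ fun i _ => (hident n i).aemeasurable_fst
  tendsto := by
    refine ProbabilityMeasure.tendsto_iff_tendsto_charFun.2 fun t => ?_
    have hpow : ∀ n, charFun (P.map fun ω => ∑ i ∈ Finset.range n, X n i ω) t
        = (1 + (charFun (P.map (X n 0)) t - 1)) ^ n := fun n => by
      rw [((hindep n).restrict _).charFun_map_fun_finsetSum_eq_prod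
        (fun i _ => (hident n i).aemeasurable_fst)]
      simp [fun i => (hident n i).map_eq]
    simp only [ProbabilityMeasure.coe_mk, Measure.map_id, hpow, charFun_gaussianReal]
    refine Complex.tendsto_one_add_pow_exp_of_tendsto ?_
    have hmain : Tendsto (fun n : ℕ => ((-(t ^ 2 / 2) * (n * ∫ ω, X n 0 ω ^ 2 ∂P) : ℝ) : ℂ)) atTop
        (𝓝 ((-(t ^ 2 / 2) * v : ℝ) : ℂ)) :=
      (Complex.continuous_ofReal.tendsto _).comp (hvar.const_mul _)
    have hrem : Tendsto (fun n : ℕ => (n : ℂ) * (charFun (P.map (X n 0)) t - 1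
        + ((t ^ 2 / 2 * ∫ ω, X n 0 ω ^ 2 ∂P : ℝ) : ℂ))) atTop (𝓝 0) := by
      have hz : Tendsto (fun n : ℕ => |t| ^ 3 * c n * (n * ∫ ω, X n 0 ω ^ 2 ∂P)) atTop (𝓝 0) := by
        simpa using (hc.const_mul (|t| ^ 3)).mul hvar
      have hsmall : ∀ᶠ n in atTop, |t| * c n ≤ 1 := by
        have : Tendsto (fun n => |t| * c n) atTop (𝓝 0) := by simpa using hc.const_mul |t|
        exact this.eventually_le_const one_pos
      refine squeeze_zero_norm' ?_ hz
      filter_upwards [hmean, hbound, hsmall] with n h1 h2 h3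
      have := norm_charFun_sub_one_add_le (hident n 0).aemeasurable_fst h1 h2 h3
      rw [norm_mul, Complex.norm_natCast]
      calc _ ≤ (n : ℝ) * (|t| ^ 3 * c n * ∫ ω, X n 0 ω ^ 2 ∂P) := by gcongr
        _ = _ := by ring
    convert hmain.add hrem using 2 with n
    · push_cast; ring
    · push_cast; ring

end BoundedTriangularArray

/-! ### Convergence in probability and logarithm bounds -/

/-- If `f n` is near `a` wherever `W n` is small and `W n → 0` in probability, then `f n → a` in
probability. No measurability of `f n` is needed. -/
theorem tendstoInMeasure_of_dominated {Ω : Type*} [MeasurableSpace Ω] {P : Measure Ω}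
    {W : ℕ → Ω → ℝ} {f : ℕ → Ω → ℝ} {a : ℝ}
    (hW : TendstoInMeasure P W atTop fun _ => 0)
    (h : ∀ ε > 0, ∃ δ > 0, ∀ᶠ n in atTop, ∀ ω, |W n ω| < δ → |f n ω - a| < ε) :
    TendstoInMeasure P f atTop fun _ => a := by
  rw [tendstoInMeasure_iff_norm] at hW ⊢
  intro ε hε
  obtain ⟨δ, hδ, hev⟩ := h ε hε
  refine tendsto_of_tendsto_of_tendsto_of_le_of_le' tendsto_const_nhds (hW δ hδ)
    (Eventually.of_forall fun _ => zero_le) ?_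
  filter_upwards [hev] with n hn
  refine measure_mono fun ω hω => ?_
  by_contra hlt
  simp only [Set.mem_ofPred_eq, not_le, sub_zero, Real.norm_eq_abs] at hlt hω
  exact absurd (hn ω hlt) (not_lt.2 hω)

theorem tendstoInMeasure_zero_of_tendsto_integral {Ω : Type*} [MeasurableSpace Ω] {P : Measure Ω}
    [IsFiniteMeasure P] {W : ℕ → Ω → ℝ} (hW : ∀ n ω, 0 ≤ W n ω) (hint : ∀ n, Integrable (W n) P)
    (hlim : Tendsto (fun n => ∫ ω, W n ω ∂P) atTop (𝓝 0)) :
    TendstoInMeasure P W atTop fun _ => 0 := by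
  rw [tendstoInMeasure_iff_measureReal_norm]
  intro ε hε
  refine squeeze_zero (fun _ => measureReal_nonneg) (fun n => ?_)
    (by simpa using hlim.div_const ε)
  rw [le_div_iff₀ hε, mul_comm]
  simpa [abs_of_nonneg (hW n _)] using
    mul_meas_ge_le_integral_of_nonneg (ae_of_all _ (hW n)) (hint n) ε

theorem abs_log_one_add_sub_le {x : ℝ} (hx : |x| ≤ 1 / 2) : |Real.log (1 + x) - x| ≤ 2 * x ^ 2 := by
  have h := Real.abs_log_sub_add_sum_range_le (x := -x) (by rw [abs_neg]; linarith) 1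
  simp only [Finset.sum_range_one, abs_neg, sub_neg_eq_add] at h
  norm_num at h
  rw [← sub_eq_neg_add] at h
  refine h.trans ?_
  rw [div_le_iff₀ (by linarith)]
  nlinarith [sq_nonneg x]

theorem abs_log_le_two_mul_abs {r : ℝ} (hr : 1 / 2 ≤ r) : |Real.log r| ≤ 2 * |1 - r| := by
  have h0 : 0 < r := by linarith
  have h1 := Real.log_le_sub_one_of_pos h0
  have h2 := Real.one_sub_inv_le_log_of_pos h0
  have h3 : -(2 * |1 - r|) ≤ 1 - r⁻¹ := by
    have : 1 - r⁻¹ = -((1 - r) * r⁻¹) := by field_simp; ring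
    rw [this, neg_le_neg_iff]
    have hi : r⁻¹ ≤ 2 := by rw [inv_le_comm₀ h0 two_pos]; linarith
    calc (1 - r) * r⁻¹ ≤ |1 - r| * 2 := by
          gcongr
          exact le_abs_self _
      _ = _ := mul_comm _ _
  rw [abs_le]
  refine ⟨h3.trans h2, ?_⟩
  have := neg_abs_le (1 - r)
  have := abs_nonneg (1 - r)
  linarith

/-! ### Tail probabilities -/

section Tail

variable {Ω : Type*} [MeasurableSpace Ω] {P : Measure Ω}
  {β : ℝ} {L : ℝ → ℝ} {k : ℕ → ℝ}

/-- The quotient `L x / L x` is `0`, not close to `1`, where `L` vanishes. -/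
theorem SlowlyVarying.eventually_ne_zero (hL : SlowlyVarying L) :
    ∀ᶠ x in atTop, L x ≠ 0 := by
  filter_upwards [(hL 1 one_pos).eventually_ne one_ne_zero] with x hx h
  simp [h] at hx

theorem tailProb_eq {X : Ω → ℕ}
    (htail : ∀ x : ℝ, 1 ≤ x → P.real {ω | x < (X ω : ℝ)} = x ^ (-β) * L x)
    {k : ℝ} (hk : 0 ≤ k) : tailProb P X k = Real.exp (-(k * β)) * L (Real.exp k) := by
  rw [tailProb, htail _ (Real.one_le_exp hk), ← Real.exp_mul, mul_neg]

theorem eventually_tailProb_pos {X : Ω → ℕ} (hL : SlowlyVarying L)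
    (htail : ∀ x : ℝ, 1 ≤ x → P.real {ω | x < (X ω : ℝ)} = x ^ (-β) * L x) :
    ∀ᶠ k in atTop, 0 < tailProb P X k := by
  filter_upwards [Real.tendsto_exp_atTop.eventually hL.eventually_ne_zero,
    eventually_ge_atTop 0] with k h1 h2
  refine lt_of_le_of_ne (by exact measureReal_nonneg) fun h => ?_
  have := tailProb_eq htail h2
  rw [← h] at this
  exact mul_ne_zero (Real.exp_ne_zero _) h1 this.symm

theorem tendsto_tailProb_div {X : Ω → ℕ} (hL : SlowlyVarying L)
    (htail : ∀ x : ℝ, 1 ≤ x → P.real {ω | x < (X ω : ℝ)} = x ^ (-β) * L x) :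
    Tendsto (fun k => tailProb P X k / tailProb P X (k + 1)) atTop (𝓝 (Real.exp β)) := by
  have h := (((hL _ (Real.exp_pos 1)).comp Real.tendsto_exp_atTop).inv₀ one_ne_zero).const_mul
    (Real.exp β)
  rw [inv_one, mul_one] at h
  refine h.congr' ?_
  filter_upwards [eventually_ge_atTop 0] with k hk
  rw [tailProb_eq htail hk, tailProb_eq htail (by linarith)]
  simp only [Function.comp, inv_div]
  rw [← Real.exp_add, mul_div_mul_comm, ← Real.exp_sub, add_comm 1 k]
  ring_nf

theorem tendsto_mul_tailProb_atTop {X : Ω → ℕ} (hL : SlowlyVarying L)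
    (htail : ∀ x : ℝ, 1 ≤ x → P.real {ω | x < (X ω : ℝ)} = x ^ (-β) * L x)
    (hk : Tendsto k atTop atTop)
    (hkL : (fun n : ℕ => Real.log n * Real.exp (k n * β) / n)
      =o[atTop] fun n : ℕ => L (Real.exp (k n))) :
    Tendsto (fun n : ℕ => (n : ℝ) * tailProb P X (k n)) atTop atTop := by
  refine tendsto_atTop_mono' _ ?_ (Real.tendsto_log_atTop.comp tendsto_natCast_atTop_atTop)
  filter_upwards [hkL.bound one_pos, hk.eventually (eventually_tailProb_pos hL htail),
    hk.eventually (eventually_ge_atTop 0), eventually_gt_atTop 0] with n h1 h2 h3 h4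
  have hn : (0 : ℝ) < n := by exact_mod_cast h4
  rw [tailProb_eq htail h3] at h2 ⊢
  have hLp : 0 < L (Real.exp (k n)) := (mul_pos_iff_of_pos_left (Real.exp_pos _)).1 h2
  rw [one_mul, Real.norm_of_nonneg hLp.le] at h1
  have h5 := (le_abs_self _).trans h1
  rw [div_le_iff₀ hn] at h5
  rw [Function.comp, Real.exp_neg]
  have := Real.exp_pos (k n * β)
  field_simp
  linarith

/-- The deterministic part of the error is negligible on the scale `1 / √(n p_k)`. -/
theorem tendsto_bias {X : Ω → ℕ} (hL : SlowlyVarying L)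
    (htail : ∀ x : ℝ, 1 ≤ x → P.real {ω | x < (X ω : ℝ)} = x ^ (-β) * L x)
    (hk : Tendsto k atTop atTop)
    (hbias : Tendsto
      (fun n : ℕ => √((n : ℝ) * tailProb P X (k n)) *
        (1 - L (Real.exp (k n)) / L (Real.exp (k n + 1)))) atTop (𝓝 0)) :
    Tendsto (fun n : ℕ => √((n : ℝ) * tailProb P X (k n)) *
      (Real.log (tailProb P X (k n)) - Real.log (tailProb P X (k n + 1)) - β)) atTop (𝓝 0) := by
  have hk1 : Tendsto (fun n => k n + 1) atTop atTop := tendsto_atTop_add_const_right _ _ hk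
  have hratio : Tendsto (fun n => L (Real.exp (k n)) / L (Real.exp (k n + 1))) atTop (𝓝 1) := by
    have h := (((hL _ (Real.exp_pos 1)).comp Real.tendsto_exp_atTop).inv₀ one_ne_zero).comp hk
    rw [inv_one] at h
    refine h.congr fun n => ?_
    simp only [Function.comp, inv_div]
    rw [← Real.exp_add, add_comm 1 (k n)]
  refine squeeze_zero_norm' ?_ (by simpa only [abs_zero, mul_zero] using hbias.abs.const_mul 2)
  filter_upwards [hratio.eventually_const_le (show (1 / 2 : ℝ) < 1 by norm_num),
    hk.eventually (eventually_tailProb_pos hL htail),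
    hk1.eventually (eventually_tailProb_pos hL htail),
    hk.eventually (eventually_ge_atTop 0)] with n h1 h2 h3 h4
  have hlog : Real.log (tailProb P X (k n)) - Real.log (tailProb P X (k n + 1)) - β
      = Real.log (L (Real.exp (k n)) / L (Real.exp (k n + 1))) := by
    rw [tailProb_eq htail h4] at h2 ⊢
    rw [tailProb_eq htail (by linarith)] at h3 ⊢
    have e1 : L (Real.exp (k n)) ≠ 0 := (right_ne_zero_of_mul h2.ne')
    have e2 : L (Real.exp (k n + 1)) ≠ 0 := (right_ne_zero_of_mul h3.ne')
    rw [Real.log_mul (Real.exp_ne_zero _) e1, Real.log_mul (Real.exp_ne_zero _) e2,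
      Real.log_div e1 e2, Real.log_exp, Real.log_exp]
    ring
  rw [hlog, norm_mul, Real.norm_eq_abs, Real.norm_eq_abs, abs_mul]
  calc _ ≤ |√((n : ℝ) * tailProb P X (k n))| *
        (2 * |1 - L (Real.exp (k n)) / L (Real.exp (k n + 1))|) := by
        gcongr
        exact abs_log_le_two_mul_abs h1
    _ = _ := by ring

end Tail

/-! ### Relative error of the empirical tail -/

section Empirical

variable {Ω : Type*} [MeasurableSpace Ω] {P : Measure Ω}
  {S : ℕ → Ω → ℕ}

/-- The indicator `𝟙{m > e^k}`, as a function of the observation `m`. -/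
noncomputable def tailIndicator (k : ℝ) (m : ℕ) : ℝ :=
  Set.indicator {m : ℕ | Real.exp k < m} (fun _ => 1) m

theorem tailIndicator_sq (k : ℝ) (m : ℕ) : tailIndicator k m ^ 2 = tailIndicator k m := by
  by_cases h : Real.exp k < m <;> simp [tailIndicator, h]

theorem tailIndicator_nonneg (k : ℝ) (m : ℕ) : 0 ≤ tailIndicator k m := by
  by_cases h : Real.exp k < m <;> simp [tailIndicator, h]

theorem tailIndicator_le_one (k : ℝ) (m : ℕ) : tailIndicator k m ≤ 1 := by
  by_cases h : Real.exp k < m <;> simp [tailIndicator, h]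

theorem tailIndicator_mul_of_le {k l : ℝ} (hkl : k ≤ l) (m : ℕ) :
    tailIndicator k m * tailIndicator l m = tailIndicator l m := by
  by_cases h : Real.exp l < m
  · have := (Real.exp_le_exp.2 hkl).trans_lt h
    simp [tailIndicator, h, this]
  · simp [tailIndicator, h]

omit [MeasurableSpace Ω] in
theorem empTail_eq (n : ℕ) (k : ℝ) (ω : Ω) :
    empTail S n k ω = (1 / n) * ∑ i ∈ Finset.range n, tailIndicator k (S i ω) := rfl

theorem aemeasurable_tailIndicator {X : Ω → ℕ} (hX : AEMeasurable X P) (k : ℝ) :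
    AEMeasurable (fun ω => tailIndicator k (X ω)) P :=
  (measurable_from_nat (f := tailIndicator k)).comp_aemeasurable hX

theorem memLp_tailIndicator [IsProbabilityMeasure P] {X : Ω → ℕ}
    (hX : AEMeasurable X P) (k : ℝ) (p : ENNReal) :
    MemLp (fun ω => tailIndicator k (X ω)) p P :=
  MemLp.of_bound (aemeasurable_tailIndicator hX k).aestronglyMeasurable 1 <| ae_of_all _ fun ω => by
    rw [Real.norm_of_nonneg (tailIndicator_nonneg _ _)]
    exact tailIndicator_le_one _ _

theorem integrable_tailIndicator [IsProbabilityMeasure P] {X : Ω → ℕ}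
    (hX : AEMeasurable X P) (k : ℝ) :
    Integrable (fun ω => tailIndicator k (X ω)) P :=
  (memLp_tailIndicator hX k 1).integrable le_rfl

theorem integral_tailIndicator {X : Ω → ℕ} (hX : AEMeasurable X P) (k : ℝ) :
    ∫ ω, tailIndicator k (X ω) ∂P = tailProb P X k := by
  have hs : NullMeasurableSet {ω | Real.exp k < (X ω : ℝ)} P :=
    hX.nullMeasurableSet_preimage (s := {m : ℕ | Real.exp k < m}) (MeasurableSet.of_discrete)
  have : (fun ω => tailIndicator k (X ω))
      = {ω | Real.exp k < (X ω : ℝ)}.indicator fun _ => (1 : ℝ) := rfl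
  rw [this, integral_indicator₀ hs]
  simp [tailProb]

theorem aemeasurable_empTail (hS : ∀ i, AEMeasurable (S i) P) (n : ℕ) (k : ℝ) :
    AEMeasurable (empTail S n k) P := by
  change AEMeasurable (fun ω => (1 / (n : ℝ)) * ∑ i ∈ Finset.range n, tailIndicator k (S i ω)) P
  exact (Finset.aemeasurable_fun_sum _ fun i _ => aemeasurable_tailIndicator (hS i) k).const_mul _

theorem aemeasurable_tailIndexEst (hS : ∀ i, AEMeasurable (S i) P) (n : ℕ) (k : ℝ) :
    AEMeasurable (tailIndexEst S n k) P := by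
  classical
  have hg : Measurable fun x : ℝ × ℝ => if x.2 = 0 then 0 else Real.log x.1 - Real.log x.2 :=
    Measurable.ite (measurable_snd (measurableSet_singleton 0)) measurable_const (by fun_prop)
  convert hg.comp_aemeasurable
    ((aemeasurable_empTail hS n k).prodMk (aemeasurable_empTail hS n (k + 1))) using 1
  ext ω
  simp only [tailIndexEst, Function.comp]

/-- Relative error `p̂_k / p_k - 1` of the empirical tail probability; it is the junk value `-1`
when `p_k = 0`. -/
noncomputable def relErr (P : Measure Ω) (S : ℕ → Ω → ℕ) (n : ℕ) (k : ℝ) (ω : Ω) : ℝ :=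
  empTail S n k ω / tailProb P (S 0) k - 1

theorem memLp_relErr [IsProbabilityMeasure P] (hS : ∀ i, AEMeasurable (S i) P) (n : ℕ) (k : ℝ) :
    MemLp (relErr P S n k) 2 P := by
  have h : MemLp (fun ω => (1 / (n : ℝ)) * ∑ i ∈ Finset.range n, tailIndicator k (S i ω)) 2 P :=
    (memLp_finsetSum _ fun i _ => memLp_tailIndicator (hS i) k 2).const_mul _
  exact (h.mul_const (tailProb P (S 0) k)⁻¹).sub (memLp_const 1)

/-- Chebyshev-type bound: the relative error at level `k` is of order `1 / √(n p_k)` in mean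
square. -/
theorem integral_relErr_sq_le [IsProbabilityMeasure P] (hindep : iIndepFun S P)
    (hident : ∀ i, IdentDistrib (S i) (S 0) P P) {n : ℕ} (hn : 0 < n) {k : ℝ}
    (hp : 0 < tailProb P (S 0) k) :
    ∫ ω, relErr P S n k ω ^ 2 ∂P ≤ 1 / (n * tailProb P (S 0) k) := by
  set p := tailProb P (S 0) k with hpdef
  have hn' : (0 : ℝ) < n := by exact_mod_cast hn
  have hS i : AEMeasurable (S i) P := (hident i).aemeasurable_fst
  have hid i : IdentDistrib (fun ω => tailIndicator k (S i ω))
      (fun ω => tailIndicator k (S 0 ω)) P P :=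
    (hident i).comp (measurable_from_nat (f := tailIndicator k))
  have hint i : ∫ ω, tailIndicator k (S i ω) ∂P = p := by
    rw [(hid i).integral_eq, integral_tailIndicator (hS 0)]
  have hsum : AEMeasurable (∑ i ∈ Finset.range n, fun ω => tailIndicator k (S i ω)) P :=
    Finset.aemeasurable_sum _ fun i _ => aemeasurable_tailIndicator (hS i) k
  have hvar : Var[∑ i ∈ Finset.range n, fun ω => tailIndicator k (S i ω); P] ≤ n * p := by
    rw [IndepFun.variance_sum (fun i _ => memLp_tailIndicator (hS i) k 2)
      (fun i _ j _ hij => (hindep.indepFun hij).comp (measurable_from_nat (f := tailIndicator k))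
        (measurable_from_nat (f := tailIndicator k)))]
    calc _ ≤ ∑ i ∈ Finset.range n, p := by
          refine Finset.sum_le_sum fun i _ => ?_
          refine (variance_le_expectation_sq
            (aemeasurable_tailIndicator (hS i) k).aestronglyMeasurable).trans_eq ?_
          simp only [Pi.pow_apply, tailIndicator_sq, hint]
      _ = n * p := by simp
  have hmean : ∫ ω, (∑ i ∈ Finset.range n, fun ω => tailIndicator k (S i ω)) ω ∂P = n * p := by
    simp only [Finset.sum_apply]
    rw [integral_finsetSum _ fun i _ => integrable_tailIndicator (hS i) k]
    simp [hint]
  rw [variance_eq_integral hsum, hmean] at hvar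
  have hrel ω : relErr P S n k ω ^ 2 = (1 / (n * p) ^ 2) *
      ((∑ i ∈ Finset.range n, fun ω => tailIndicator k (S i ω)) ω - n * p) ^ 2 := by
    rw [relErr, empTail_eq, ← hpdef, Finset.sum_apply]
    field_simp
  simp only [hrel]
  rw [integral_const_mul]
  calc _ ≤ 1 / (n * p) ^ 2 * (n * p) := by gcongr
    _ = _ := by field_simp

end Empirical

/-! ### Linearisation of the estimator -/

section Estimator

variable {Ω : Type*} [MeasurableSpace Ω] {P : Measure Ω}
  {S : ℕ → Ω → ℕ} {k : ℕ → ℝ} {β : ℝ}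

/-- The standardised difference of the relative errors at `k n` and `k n + 1` is asymptotically
normal. With `p = p_k`, `q = p_{k+1}` it is a row sum of the i.i.d. variables
`√(p / n) * (𝟙{S > e^k} / p - 𝟙{S > e^(k+1)} / q)`, which are bounded by `(p / q) / √(n p)` and have
second moment `(p / q - 1) / n`. -/
theorem tendstoInDistribution_relErr_sub [IsProbabilityMeasure P] (hβ : 0 < β) (hindep : iIndepFun S P)
    (hident : ∀ i, IdentDistrib (S i) (S 0) P P)
    (hp : ∀ᶠ n in atTop, 0 < tailProb P (S 0) (k n))
    (hq : ∀ᶠ n in atTop, 0 < tailProb P (S 0) (k n + 1))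
    (hratio : Tendsto (fun n => tailProb P (S 0) (k n) / tailProb P (S 0) (k n + 1)) atTop
      (𝓝 (Real.exp β)))
    (hnp : Tendsto (fun n : ℕ => (n : ℝ) * tailProb P (S 0) (k n)) atTop atTop) :
    TendstoInDistribution
      (fun (n : ℕ) ω => √((n : ℝ) * tailProb P (S 0) (k n)) *
        (relErr P S n (k n) ω - relErr P S n (k n + 1) ω))
      atTop (id : ℝ → ℝ) (fun _ => P) (gaussianReal 0 (Real.exp β - 1).toNNReal) := by
  set p : ℕ → ℝ := fun n => tailProb P (S 0) (k n) with hpdef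
  set q : ℕ → ℝ := fun n => tailProb P (S 0) (k n + 1) with hqdef
  have hS i : AEMeasurable (S i) P := (hident i).aemeasurable_fst
  let g : ℕ → ℕ → ℝ := fun n m =>
    √(p n / n) * (tailIndicator (k n) m / p n - tailIndicator (k n + 1) m / q n)
  have hsum : (fun (n : ℕ) ω => √((n : ℝ) * p n) *
      (relErr P S n (k n) ω - relErr P S n (k n + 1) ω))
      = fun n ω => ∑ i ∈ Finset.range n, g n (S i ω) := by
    ext n ω
    rcases Nat.eq_zero_or_pos n with rfl | hn
    · simp
    have hn' : (0 : ℝ) < n := by exact_mod_cast hn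
    have hsq : √((n : ℝ) * p n) * (1 / n) = √(p n / n) := by
      rw [Real.sqrt_mul hn'.le, Real.sqrt_div' _ hn'.le]
      have := Real.mul_self_sqrt hn'.le
      have h0 := (Real.sqrt_pos.2 hn').ne'
      field_simp
      linear_combination √(p n) * this
    simp only [g]
    rw [← Finset.mul_sum, Finset.sum_sub_distrib, ← Finset.sum_div, ← Finset.sum_div, ← hsq,
      relErr, relErr, empTail_eq, empTail_eq]
    ring
  rw [hsum]
  have hle n : q n ≤ p n := by
    refine measureReal_mono fun ω hω => ?_
    exact (Real.exp_le_exp.2 (by linarith)).trans_lt hω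
  refine tendstoInDistribution_sum_of_bounded (c := fun n => p n / q n / √(n * p n))
    (fun n => hindep.comp (fun _ => g n) fun _ => measurable_from_nat)
    (fun n i => (hident i).comp (u := g n) measurable_from_nat) ?_ ?_ ?_ ?_
  · filter_upwards [hp, hq] with n h1 h2
    simp only [g]
    rw [integral_const_mul, integral_sub ((integrable_tailIndicator (hS 0) _).div_const _)
      ((integrable_tailIndicator (hS 0) _).div_const _), integral_div, integral_div,
      integral_tailIndicator (hS 0), integral_tailIndicator (hS 0), div_self h1.ne',
      div_self h2.ne', sub_self, mul_zero]
  · filter_upwards [hp, hq, eventually_gt_atTop 0] with n h1 h2 hn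
    refine ae_of_all _ fun ω => ?_
    have hn' : (0 : ℝ) < n := by exact_mod_cast hn
    change 0 < p n at h1
    change 0 < q n at h2
    have hc : p n / q n / √(n * p n) = √(p n / n) * (1 / q n) := by
      rw [Real.sqrt_mul hn'.le, Real.sqrt_div' _ hn'.le]
      have := Real.mul_self_sqrt h1.le
      have h0 := (Real.sqrt_pos.2 hn').ne'
      have h0' := (Real.sqrt_pos.2 h1).ne'
      field_simp
      rw [sq]; linear_combination -this
    rw [hc]
    simp only [g]
    rw [abs_mul, abs_of_nonneg (Real.sqrt_nonneg _)]
    gcongr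
    have a0 : 0 ≤ tailIndicator (k n) (S 0 ω) / p n :=
      div_nonneg (tailIndicator_nonneg _ _) h1.le
    have b0 : 0 ≤ tailIndicator (k n + 1) (S 0 ω) / q n :=
      div_nonneg (tailIndicator_nonneg _ _) h2.le
    have a1 : tailIndicator (k n) (S 0 ω) / p n ≤ 1 / q n :=
      div_le_div₀ zero_le_one (tailIndicator_le_one _ _) h2 (hle n)
    have b1 : tailIndicator (k n + 1) (S 0 ω) / q n ≤ 1 / q n := by
      gcongr; exact tailIndicator_le_one _ _
    rw [abs_le]
    constructor <;> linarith
  · exact hratio.div_atTop (Real.tendsto_sqrt_atTop.comp hnp)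
  · rw [Real.coe_toNNReal _ (by linarith [Real.add_one_le_exp β])]
    refine (hratio.sub_const 1).congr' ?_
    filter_upwards [hp, hq, eventually_gt_atTop 0] with n h1 h2 hn
    have hn' : (0 : ℝ) < n := by exact_mod_cast hn
    change 0 < p n at h1
    change 0 < q n at h2
    -- the indicators are nested, so their product is the smaller one
    have hsq m : g n m ^ 2 = (p n / n) * (tailIndicator (k n) m / p n ^ 2
        + (1 / q n ^ 2 - 2 / (p n * q n)) * tailIndicator (k n + 1) m) := by
      simp only [g]
      rw [mul_pow, Real.sq_sqrt (by positivity)]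
      have e1 := tailIndicator_sq (k n) m
      have e2 := tailIndicator_sq (k n + 1) m
      have e3 := tailIndicator_mul_of_le (show k n ≤ k n + 1 by linarith) m
      congr 1
      field_simp
      linear_combination q n ^ 2 * e1 + p n ^ 2 * e2 - 2 * p n * q n * e3
    simp only [hsq]
    rw [integral_const_mul, integral_add ((integrable_tailIndicator (hS 0) _).div_const _)
      ((integrable_tailIndicator (hS 0) _).const_mul _), integral_div, integral_const_mul,
      integral_tailIndicator (hS 0), integral_tailIndicator (hS 0)]
    change p n / q n - 1 = n * (p n / n * (p n / p n ^ 2 + (1 / q n ^ 2 - 2 / (p n * q n)) * q n))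
    field_simp
    ring

/-- The squared relative errors at both levels are negligible even after multiplication by
`√(n p_k)`: the remainder of the delta method vanishes. -/
theorem tendstoInMeasure_relErr_sq [IsProbabilityMeasure P] (hindep : iIndepFun S P)
    (hident : ∀ i, IdentDistrib (S i) (S 0) P P)
    (hp : ∀ᶠ n in atTop, 0 < tailProb P (S 0) (k n))
    (hq : ∀ᶠ n in atTop, 0 < tailProb P (S 0) (k n + 1))
    (hratio : Tendsto (fun n => tailProb P (S 0) (k n) / tailProb P (S 0) (k n + 1)) atTop
      (𝓝 (Real.exp β)))
    (hnp : Tendsto (fun n : ℕ => (n : ℝ) * tailProb P (S 0) (k n)) atTop atTop) :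
    TendstoInMeasure P (fun (n : ℕ) ω => √((n : ℝ) * tailProb P (S 0) (k n)) *
      (relErr P S n (k n) ω ^ 2 + relErr P S n (k n + 1) ω ^ 2)) atTop fun _ => 0 := by
  have hS i : AEMeasurable (S i) P := (hident i).aemeasurable_fst
  have hint n l : Integrable (fun ω => relErr P S n l ω ^ 2) P := (memLp_relErr hS n l).integrable_sq
  refine tendstoInMeasure_zero_of_tendsto_integral (fun n ω => by positivity)
    (fun n => ((hint _ _).add (hint _ _)).const_mul _) ?_
  have hlim : Tendsto (fun n : ℕ =>
      (1 + tailProb P (S 0) (k n) / tailProb P (S 0) (k n + 1)) /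
        √((n : ℝ) * tailProb P (S 0) (k n))) atTop (𝓝 0) :=
    (hratio.const_add 1).div_atTop (Real.tendsto_sqrt_atTop.comp hnp)
  refine squeeze_zero' (Eventually.of_forall fun n => integral_nonneg fun ω => ?_) ?_ hlim
  · dsimp only [Pi.zero_apply]; positivity
  filter_upwards [hp, hq, eventually_gt_atTop 0] with n h1 h2 hn
  have hn' : (0 : ℝ) < n := by exact_mod_cast hn
  rw [integral_const_mul, integral_add (hint _ _) (hint _ _)]
  calc _ ≤ √((n : ℝ) * tailProb P (S 0) (k n)) * (1 / (n * tailProb P (S 0) (k n))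
        + 1 / (n * tailProb P (S 0) (k n + 1))) := by
        gcongr
        · exact integral_relErr_sq_le hindep hident hn h1
        · exact integral_relErr_sq_le hindep hident hn h2
    _ = _ := by
        have hs := Real.mul_self_sqrt (mul_pos hn' h1).le
        have hs0 := (Real.sqrt_pos.2 (mul_pos hn' h1)).ne'
        generalize √((n : ℝ) * tailProb P (S 0) (k n)) = s at hs hs0 ⊢
        field_simp
        rw [sq, hs]

theorem empTail_eq_mul_one_add_relErr {l : ℝ} (h : 0 < tailProb P (S 0) l) (n : ℕ) (ω : Ω) :
    empTail S n l ω = tailProb P (S 0) l * (1 + relErr P S n l ω) := by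
  rw [relErr]
  field_simp
  ring

/-- When both relative errors are below one, the fallback value of the estimator is not used. -/
theorem tailIndexEst_eq {l : ℝ} (hp : 0 < tailProb P (S 0) l) (hq : 0 < tailProb P (S 0) (l + 1))
    {n : ℕ} {ω : Ω} (hU : |relErr P S n l ω| < 1) (hV : |relErr P S n (l + 1) ω| < 1) :
    tailIndexEst S n l ω = Real.log (tailProb P (S 0) l) - Real.log (tailProb P (S 0) (l + 1))
      + Real.log (1 + relErr P S n l ω) - Real.log (1 + relErr P S n (l + 1) ω) := by
  have hU' : 0 < 1 + relErr P S n l ω := by linarith [(abs_lt.1 hU).1]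
  have hV' : 0 < 1 + relErr P S n (l + 1) ω := by linarith [(abs_lt.1 hV).1]
  rw [tailIndexEst, empTail_eq_mul_one_add_relErr hp, empTail_eq_mul_one_add_relErr hq,
    if_neg (mul_pos hq hV').ne', Real.log_mul hp.ne' hU'.ne', Real.log_mul hq.ne' hV'.ne']
  ring

/-- Asymptotic linearisation of the estimator in the relative errors. -/
theorem tendstoInMeasure_est_sub_linear
    (hp : ∀ᶠ n in atTop, 0 < tailProb P (S 0) (k n))
    (hq : ∀ᶠ n in atTop, 0 < tailProb P (S 0) (k n + 1))
    (hnp : Tendsto (fun n : ℕ => (n : ℝ) * tailProb P (S 0) (k n)) atTop atTop)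
    (hbias : Tendsto (fun n : ℕ => √((n : ℝ) * tailProb P (S 0) (k n)) *
      (Real.log (tailProb P (S 0) (k n)) - Real.log (tailProb P (S 0) (k n + 1)) - β))
      atTop (𝓝 0))
    (hW : TendstoInMeasure P (fun (n : ℕ) ω => √((n : ℝ) * tailProb P (S 0) (k n)) *
      (relErr P S n (k n) ω ^ 2 + relErr P S n (k n + 1) ω ^ 2)) atTop fun _ => 0) :
    TendstoInMeasure P (fun (n : ℕ) ω =>
      √((n : ℝ) * tailProb P (S 0) (k n)) * (tailIndexEst S n (k n) ω - β)
      - √((n : ℝ) * tailProb P (S 0) (k n)) *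
        (relErr P S n (k n) ω - relErr P S n (k n + 1) ω)) atTop fun _ => 0 := by
  refine tendstoInMeasure_of_dominated hW fun ε hε => ⟨min (ε / 4) (1 / 4), by positivity, ?_⟩
  filter_upwards [hp, hq, (Real.tendsto_sqrt_atTop.comp hnp).eventually_ge_atTop 1,
    hbias.abs.eventually_lt_const (show |(0 : ℝ)| < ε / 2 by simpa using hε)] with n h1 h2 h3 h4 ω hω
  simp only [Function.comp] at h3
  set s := √((n : ℝ) * tailProb P (S 0) (k n))
  set U := relErr P S n (k n) ω
  set V := relErr P S n (k n + 1) ω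
  rw [abs_of_nonneg (by positivity), lt_min_iff] at hω
  have hsU : U ^ 2 + V ^ 2 ≤ s * (U ^ 2 + V ^ 2) := le_mul_of_one_le_left (by positivity) h3
  have hU : |U| ≤ 1 / 2 := abs_le_of_sq_le_sq (by nlinarith [sq_nonneg V, hω.2]) (by norm_num)
  have hV : |V| ≤ 1 / 2 := abs_le_of_sq_le_sq (by nlinarith [sq_nonneg U, hω.2]) (by norm_num)
  have hlU := abs_log_one_add_sub_le hU
  have hlV := abs_log_one_add_sub_le hV
  rw [tailIndexEst_eq h1 h2 (hU.trans_lt (by norm_num)) (hV.trans_lt (by norm_num)), sub_zero]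
  change |s * (_ + Real.log (1 + U) - Real.log (1 + V) - β) - s * (U - V)| < ε
  set b := Real.log (tailProb P (S 0) (k n)) - Real.log (tailProb P (S 0) (k n + 1))
  have e : s * (b + Real.log (1 + U) - Real.log (1 + V) - β) - s * (U - V)
      = s * (b - β) + s * ((Real.log (1 + U) - U) - (Real.log (1 + V) - V)) := by ring
  rw [e]
  have hs0 : 0 ≤ s := by linarith
  calc _ ≤ |s * (b - β)| + |s * ((Real.log (1 + U) - U) - (Real.log (1 + V) - V))| := abs_add_le _ _
    _ ≤ |s * (b - β)| + s * (2 * U ^ 2 + 2 * V ^ 2) := by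
        rw [abs_mul s ((Real.log (1 + U) - U) - _), abs_of_nonneg hs0]
        gcongr
        exact (abs_sub _ _).trans (add_le_add hlU hlV)
    _ < ε / 2 + ε / 2 := by
        refine add_lt_add h4 ?_
        linarith [hω.1]
    _ = ε := by ring

/-- The factor `√(p̂_k / p_k) / √(exp β̂ - 1)`, which turns the deterministic normalisation of the
estimator into the random one, converges in probability. On the good event
`exp β̂ = p̂_k / p̂_{k+1}`, so consistency of `β̂` is not needed. -/
theorem tendstoInMeasure_normalisation (hβ : 0 < β)
    (hp : ∀ᶠ n in atTop, 0 < tailProb P (S 0) (k n))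
    (hq : ∀ᶠ n in atTop, 0 < tailProb P (S 0) (k n + 1))
    (hratio : Tendsto (fun n => tailProb P (S 0) (k n) / tailProb P (S 0) (k n + 1)) atTop
      (𝓝 (Real.exp β)))
    (hnp : Tendsto (fun n : ℕ => (n : ℝ) * tailProb P (S 0) (k n)) atTop atTop)
    (hW : TendstoInMeasure P (fun (n : ℕ) ω => √((n : ℝ) * tailProb P (S 0) (k n)) *
      (relErr P S n (k n) ω ^ 2 + relErr P S n (k n + 1) ω ^ 2)) atTop fun _ => 0) :
    TendstoInMeasure P (fun (n : ℕ) ω => √(1 + relErr P S n (k n) ω) /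
      √(Real.exp (tailIndexEst S n (k n) ω) - 1)) atTop fun _ => 1 / √(Real.exp β - 1) := by
  have hpos : 0 < Real.exp β - 1 := by linarith [Real.add_one_le_exp β]
  -- on the good event the ratio is this function of the two relative errors and of `p_k / p_{k+1}`
  let F : ℝ × ℝ × ℝ → ℝ := fun x => √(1 + x.1) / √(x.2.2 * (1 + x.1) / (1 + x.2.1) - 1)
  have hF : ContinuousAt F (0, 0, Real.exp β) := by
    refine ContinuousAt.div (by fun_prop) ?_ ?_
    · exact Real.continuous_sqrt.continuousAt.comp
        (((by fun_prop : ContinuousAt (fun x : ℝ × ℝ × ℝ => x.2.2 * (1 + x.1)) _).div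
          (by fun_prop) (by simp)).sub continuousAt_const)
    · simpa using (Real.sqrt_pos.2 hpos).ne'
  have hF0 : F (0, 0, Real.exp β) = 1 / √(Real.exp β - 1) := by simp [F]
  rw [Metric.continuousAt_iff, hF0] at hF
  refine tendstoInMeasure_of_dominated hW fun ε hε => ?_
  obtain ⟨δ, hδ, hδF⟩ := hF ε hε
  refine ⟨min (δ ^ 2) 1, by positivity, ?_⟩
  filter_upwards [hp, hq, (Real.tendsto_sqrt_atTop.comp hnp).eventually_ge_atTop 1,
    Metric.tendsto_nhds.1 hratio δ hδ] with n h1 h2 h3 h4 ω hω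
  simp only [Function.comp] at h3
  set s := √((n : ℝ) * tailProb P (S 0) (k n))
  set U := relErr P S n (k n) ω with hUdef
  set V := relErr P S n (k n + 1) ω with hVdef
  rw [abs_of_nonneg (by positivity), lt_min_iff] at hω
  have hsU : U ^ 2 + V ^ 2 ≤ s * (U ^ 2 + V ^ 2) := le_mul_of_one_le_left (by positivity) h3
  have hU1 : |U| < 1 := abs_lt_of_sq_lt_sq (by nlinarith [sq_nonneg V, hω.2]) zero_le_one
  have hV1 : |V| < 1 := abs_lt_of_sq_lt_sq (by nlinarith [sq_nonneg U, hω.2]) zero_le_one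
  have hUδ : |U| < δ := abs_lt_of_sq_lt_sq (by nlinarith [sq_nonneg V, hω.1]) hδ.le
  have hVδ : |V| < δ := abs_lt_of_sq_lt_sq (by nlinarith [sq_nonneg U, hω.1]) hδ.le
  have hU' : 0 < 1 + U := by linarith [(abs_lt.1 hU1).1]
  have hV' : 0 < 1 + V := by linarith [(abs_lt.1 hV1).1]
  have hexp : Real.exp (tailIndexEst S n (k n) ω)
      = tailProb P (S 0) (k n) / tailProb P (S 0) (k n + 1) * (1 + U) / (1 + V) := by
    rw [tailIndexEst_eq h1 h2 hU1 hV1, Real.exp_sub, Real.exp_add, Real.exp_sub,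
      Real.exp_log h1, Real.exp_log h2, Real.exp_log hU', Real.exp_log hV']
  rw [hexp]
  refine hδF (x := (U, V, tailProb P (S 0) (k n) / tailProb P (S 0) (k n + 1))) ?_
  simp only [Prod.dist_eq, max_lt_iff]
  exact ⟨by simpa using hUδ, by simpa using hVδ, h4⟩

end Estimator

/-! ### Asymptotic normality -/

theorem corollary2
    {Ω : Type*} [MeasurableSpace Ω] (P : Measure Ω) [IsProbabilityMeasure P]
    (β : ℝ) (hβ : 0 < β)
    (L : ℝ → ℝ) (hL : SlowlyVarying L)
    -- the i.i.d. sample, with values in the positive integers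
    (S : ℕ → Ω → ℕ)
    (hpos : ∀ i, ∀ᵐ ω ∂P, 1 ≤ S i ω)
    (hindep : iIndepFun S P)
    (hident : ∀ i, IdentDistrib (S i) (S 0) P P)
    -- generalized discrete Pareto tail
    (htail : ∀ x : ℝ, 1 ≤ x → P.real {ω | x < (S 0 ω : ℝ)} = x ^ (-β) * L x)
    -- the levels
    (k : ℕ → ℝ) (hk : Tendsto k atTop atTop)
    (hkL : (fun n : ℕ => Real.log n * Real.exp (k n * β) / n)
      =o[atTop] fun n : ℕ => L (Real.exp (k n)))
    (hkn : k =o[atTop] fun n : ℕ => (n : ℝ))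
    -- the bias condition
    (hbias : Tendsto
      (fun n : ℕ => √((n : ℝ) * tailProb P (S 0) (k n)) *
        (1 - L (Real.exp (k n)) / L (Real.exp (k n + 1)))) atTop (𝓝 0)) :
    TendstoInDistribution
      (fun (n : ℕ) (ω : Ω) =>
        √((n : ℝ) * tailProb P (S 0) (k n)) * (tailIndexEst S n (k n) ω - β))
      atTop (id : ℝ → ℝ) (fun _ => P) (gaussianReal 0 (Real.exp β - 1).toNNReal) ∧
    TendstoInDistribution
      (fun (n : ℕ) (ω : Ω) =>
        √((n : ℝ) * empTail S n (k n) ω) * (tailIndexEst S n (k n) ω - β) /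
          √(Real.exp (tailIndexEst S n (k n) ω) - 1))
      atTop (id : ℝ → ℝ) (fun _ => P) (gaussianReal 0 1) := by
  have hS i : AEMeasurable (S i) P := (hident i).aemeasurable_fst
  have hp := hk.eventually (eventually_tailProb_pos hL htail)
  have hq := (tendsto_atTop_add_const_right _ 1 hk).eventually (eventually_tailProb_pos hL htail)
  have hratio := (tendsto_tailProb_div hL htail).comp hk
  have hnp := tendsto_mul_tailProb_atTop hL htail hk hkL
  have hW := tendstoInMeasure_relErr_sq hindep hident hp hq hratio hnp
  have hest n : AEMeasurable (tailIndexEst S n (k n)) P := aemeasurable_tailIndexEst hS n (k n)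
  have hemp n : AEMeasurable (empTail S n (k n)) P := aemeasurable_empTail hS n (k n)
  have hclt : TendstoInDistribution
      (fun (n : ℕ) (ω : Ω) =>
        √((n : ℝ) * tailProb P (S 0) (k n)) * (tailIndexEst S n (k n) ω - β))
      atTop (id : ℝ → ℝ) (fun _ => P) (gaussianReal 0 (Real.exp β - 1).toNNReal) :=
    tendstoInDistribution_of_tendstoInMeasure_sub _ _
      (tendstoInDistribution_relErr_sub hβ hindep hident hp hq hratio hnp)
      (tendstoInMeasure_est_sub_linear hp hq hnp (tendsto_bias hL htail hk hbias) hW)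
      fun n => ((hest n).sub_const β).const_mul _
  refine ⟨hclt, ?_⟩
  have hβ1 : 0 < Real.exp β - 1 := by linarith [Real.add_one_le_exp β]
  have hrel n : AEMeasurable (relErr P S n (k n)) P := ((hemp n).div_const _).sub_const 1
  have hfac n : AEMeasurable (fun ω => √(1 + relErr P S n (k n) ω) /
      √(Real.exp (tailIndexEst S n (k n) ω) - 1)) P := by
    have := hrel n
    have := hest n
    fun_prop
  have hslutsky := hclt.continuous_comp_prodMk_of_tendstoInMeasure_const
    (g := fun x : ℝ × ℝ => x.1 * x.2) (by fun_prop)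
    (tendstoInMeasure_normalisation hβ hp hq hratio hnp hW) hfac
  -- rescaling `𝒩(0, e^β - 1)` by its standard deviation gives `𝒩(0, 1)`
  have hgauss : (gaussianReal 0 (Real.exp β - 1).toNNReal).map
      (fun x => x * (1 / √(Real.exp β - 1))) = gaussianReal 0 1 := by
    rw [gaussianReal_map_mul_const]
    congr 1
    · simp
    · ext
      simp [Real.sq_sqrt hβ1.le, max_eq_left hβ1.le, hβ1.ne']
  have hstd : TendstoInDistribution
      (fun (n : ℕ) (ω : Ω) =>
        √((n : ℝ) * tailProb P (S 0) (k n)) * (tailIndexEst S n (k n) ω - β) *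
          (√(1 + relErr P S n (k n) ω) / √(Real.exp (tailIndexEst S n (k n) ω) - 1)))
      atTop (id : ℝ → ℝ) (fun _ => P) (gaussianReal 0 1) := by
    refine ⟨hslutsky.forall_aemeasurable, aemeasurable_id, ?_⟩
    convert hslutsky.tendsto using 3
    refine congrArg 𝓝 (Subtype.ext ?_)
    simpa using hgauss.symm
  refine tendstoInDistribution_of_tendstoInMeasure_sub _ _ hstd ?_ fun n => ?_
  · refine tendstoInMeasure_of_dominated (a := 0) hW fun ε hε => ⟨1, one_pos, ?_⟩
    -- the two normalisations agree exactly as soon as `p_k > 0`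
    filter_upwards [hp] with n h1 ω _
    have hsplit : √((n : ℝ) * empTail S n (k n) ω)
        = √((n : ℝ) * tailProb P (S 0) (k n)) * √(1 + relErr P S n (k n) ω) := by
      rw [empTail_eq_mul_one_add_relErr h1, ← mul_assoc, Real.sqrt_mul (by positivity)]
    simp only [Pi.sub_apply, hsplit]
    convert hε using 1
    rw [abs_eq_zero]
    ring
  · have := hest n
    have := hemp n
    fun_prop
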